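/- **Setting.** Two plates have mid-surfaces $S$ and $\tilde S$, each a bounded Lipschitz domain described in Cartesian coordinates of its own plane, the two planes being placed in $\mathbb R^3$ by isometric affine embeddings. In $\mathbb R^3$ the junction $\Gamma=\partial S\cap\partial\tilde S$ is a non-degenerate straight segment. Let $n,\tilde n$ be the (constant) outer unit normals of $S,\tilde S$ on $\Gamma$, $t,\tilde t$ the tangents obtained from $n,\tilde n$ by rotation by $+\pi/2$ in the plate coordinates, $l=n\times t$, and assume $\tilde n=n\cos\theta-l\sin\theta$ and $\tilde t=-t$ in $\mathbb R^3$, with $0<\theta<\pi$. The plate $S$ is clamped on a measurable set $\partial S_0\subset\partial S$ of positive length which meets $\Gamma$ in a null set. Both plates have thickness $e>0$, Young's modulus $E>0$ and Poisson ratio $\nu\in(-1,1)$. On symmetric $2\times2$ matrices, $\mathbb S$, put $$C_1A=\tfrac{Ee}{1-\nu^2}\big((1-\nu)A+\nu\,\mathrm{tr}(A)I\big),\qquad C_2A=\tfrac{Ee^3}{12(1-\nu^2)}\big((1-\nu)A+\nu\,\mathrm{tr}(A)I\big).$$ **Spaces.** Let $V=L^2(S;\mathbb R^2)\times L^2(S)\times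 L^2(\tilde S;\mathbb R^2)\times L^2(\tilde S)$ and $\Sigma_{L^2}=L^2(S;\mathbb S)^2\times L^2(\tilde S;\mathbb S)^2$ with their $L^2$ inner products. Let $W\subset V$ be the space of all $\psi=(v,v_3;\tilde v,\tilde v_3)\in H^1(S;\mathbb R^2)\times H^2(S)\times H^1(\tilde S;\mathbb R^2)\times H^2(\tilde S)$ that satisfy, in the sense of traces, $v=0$, $v_3=0$, $\partial_nv_3=0$ on $\partial S_0$, and on $\Gamma$ $$\partial_nv_3=-\partial_{\tilde n}\tilde v_3,\quad v_1=\tilde v_1\cos\theta-\tilde v_3\sin\theta,\quad v_2=-\tilde v_2,\quad v_3=-\tilde v_1\sin\theta-\tilde v_3\cos\theta,$$ where on $\Gamma$ one writes $v_1=v\cdot n$, $v_2=v\cdot t$, $\tilde v_1=\tilde v\cdot\tilde n$, $\tilde v_2=\tilde v\cdot\tilde t$. **Operators.** Let $B\psi=(-\nabla^sv,\nabla^2v_3;-\nabla^s\tilde v,\nabla^2\tilde v_3)\in\Sigma_{L^2}$ for $\psi\in W$, where $\nabla^s$ is the symmetric gradient and derivatives are weak. $B$ is an unbounded operator from $V$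 to $\Sigma_{L^2}$ with dense domain $W$. Let $B^*$ be its adjoint: $\Sigma:=D(B^*)$ is the set of $\Psi\in\Sigma_{L^2}$ for which there is $G\in V$ with $(B\psi,\Psi)_{\Sigma_{L^2}}=(G,\psi)_V$ for all $\psi\in W$, and $B^*\Psi:=G$. Let $C(\tau,\kappa;\tilde\tau,\tilde\kappa)=(C_1\tau,C_2\kappa;C_1\tilde\tau,C_2\tilde\kappa)$, and for $\Phi=(N,M;\tilde N,\tilde M)$, $\Psi=(\tau,\kappa;\tilde\tau,\tilde\kappa)$ in $\Sigma_{L^2}$ let $$(\Phi,\Psi)_{C^{-1}}=(C_1^{-1}N,\tau)_S+(C_2^{-1}M,\kappa)_S+(C_1^{-1}\tilde N,\tilde\tau)_{\tilde S}+(C_2^{-1}\tilde M,\tilde\kappa)_{\tilde S}.$$ For $\phi=(u,u_3;\tilde u,\tilde u_3)$ and $\psi=(v,v_3;\tilde v,\tilde v_3)$ in $W$ let $$D(\phi,\psi)=\int_S C_1\nabla^su:\nabla^sv+\int_S C_2\nabla^2u_3:\nabla^2v_3+\int_{\tilde S}C_1\nabla^s\tilde u:\nabla^s\tilde v+\int_{\tilde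 S}C_2\nabla^2\tilde u_3:\nabla^2\tilde v_3 .$$ **Theorem.** Let $F\in V$ and let $\phi\in W$ solve the displacement problem $$D(\phi,\psi)=(F,\psi)_V\quad\text{for all }\psi\in W.$$ Then $\Phi:=-C\,B\phi$ belongs to $\Sigma$, and $(\Phi,\phi)\in\Sigma\times V$ solves the mixed problem $$(\Phi,\Psi)_{C^{-1}}+(B^*\Psi,\phi)_V=0\quad\text{for all }\Psi\in\Sigma,\qquad (B^*\Phi,\psi)_V=-(F,\psi)_V\quad\text{for all }\psi\in V.$$ -/

import Mathlib

open MeasureTheory Filter Topology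
open scoped ContDiff

noncomputable section

namespace Plates

/-- Coordinates in the plane of a plate. -/
abbrev R2 : Type := EuclideanSpace ℝ (Fin 2)

/-- Physical space. -/
abbrev R3 : Type := EuclideanSpace ℝ (Fin 3)

/-- The coordinate vectors of the plane. -/
abbrev basisVec (i : Fin 2) : R2 := EuclideanSpace.single i 1

/-- Rotation of the plane by the angle `+π/2`. -/
def rot (n : R2) : R2 := !₂[-n 1, n 0]

/-- The vector product of physical space. -/
def cross (a b : R3) : R3 :=
  WithLp.toLp 2 (crossProduct a.ofLp b.ofLp)

/-! ### Symmetric tensors -/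

/-- Symmetric `2 × 2` matrices with the Frobenius inner product `A : B = ∑ i j, A i j * B i j`. -/
def symSubmodule : Submodule ℝ (EuclideanSpace ℝ (Fin 2 × Fin 2)) where
  carrier := {A | ∀ i j, A (i, j) = A (j, i)}
  add_mem' := by
    intro A B hA hB i j
    simp [hA i j, hB i j]
  zero_mem' := by
    intro i j
    simp
  smul_mem' := by
    intro c A hA i j
    simp [hA i j]

/-- The space `𝕊` of symmetric `2 × 2` matrices. -/
def Sym : Type := symSubmodule

instance : NormedAddCommGroup Sym := inferInstanceAs (NormedAddCommGroup symSubmodule)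

instance : InnerProductSpace ℝ Sym := inferInstanceAs (InnerProductSpace ℝ symSubmodule)

instance : CompleteSpace Sym := inferInstanceAs (CompleteSpace symSubmodule)

/-- The inclusion of the symmetric matrices into all matrices. -/
def symIncl : Sym →L[ℝ] EuclideanSpace ℝ (Fin 2 × Fin 2) := symSubmodule.subtypeL

/-- The symmetric part of the matrix unit with a one in position `(i, j)`. -/
def symUnit (i j : Fin 2) : Sym :=
  ⟨(1 / 2 : ℝ) • (EuclideanSpace.single (i, j) 1 + EuclideanSpace.single (j, i) 1), by
    intro k l
    simp only [PiLp.smul_apply, PiLp.add_apply, PiLp.single_apply, Prod.mk.injEq,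
      smul_eq_mul]
    congr 1
    rw [add_comm]
    congr 1 <;> simp only [and_comm]⟩

/-- The identity matrix. -/
def symOne : Sym := symUnit 0 0 + symUnit 1 1

/-- The trace of a symmetric matrix. -/
def symTrace : Sym →L[ℝ] ℝ :=
  ContinuousLinearMap.comp
    (EuclideanSpace.proj (0, 0) + EuclideanSpace.proj (1, 1) :
      EuclideanSpace ℝ (Fin 2 × Fin 2) →L[ℝ] ℝ) symIncl

/-! ### Geometry of planar domains -/

/-- Bounded Lipschitz domains of the plane: non-empty bounded connected open sets that near each
boundary point are, in suitable Cartesian coordinates, the part strictly above the graph of a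
Lipschitz function. -/
structure IsLipschitzDomain (D : Set R2) : Prop where
  isOpen : IsOpen D
  isConnected : IsConnected D
  isBounded : Bornology.IsBounded D
  lipschitz : ∀ x ∈ frontier D, ∃ (A : R2 ≃ᵃⁱ[ℝ] R2) (f : ℝ → ℝ) (K : NNReal),
    LipschitzWith K f ∧ ∀ᶠ y in 𝓝 x, (y ∈ D ↔ f (A y 0) < A y 1)

/-- `n` is the outer unit normal of `D` at the boundary point `x`: every closed cone strictly
inside the half plane `⟪y - x, n⟫ < 0` lies in `D` near `x` (up to its apex), and every closed cone
strictly inside the opposite half plane lies outside `D` near `x`. -/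
def IsOuterUnitNormal (D : Set R2) (x n : R2) : Prop :=
  ‖n‖ = 1 ∧ ∀ ε : ℝ, 0 < ε → ∀ᶠ y in 𝓝 x,
    (inner ℝ (y - x) n < -(ε * ‖y - x‖) → y ∈ D) ∧
    (ε * ‖y - x‖ < inner ℝ (y - x) n → y ∉ D)

/-- Arc length on the boundary of `D`. -/
abbrev bdryMeasure (D : Set R2) : Measure R2 :=
  (Measure.hausdorffMeasure 1 : Measure R2).restrict (frontier D)

/-! ### Sobolev spaces on a planar domain -/

/-- `L²(D; E)`. -/
abbrev L2 (D : Set R2) (E : Type) [NormedAddCommGroup E] : Type :=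
  Lp E 2 ((volume : Measure R2).restrict D)

/-- `g ∈ L²(D)` is the weak partial derivative `∂ᵢ u` on `D` of `u ∈ L²(D)`. -/
def IsWeakPartial (D : Set R2) (i : Fin 2) (u g : L2 D ℝ) : Prop :=
  ∀ η : R2 → ℝ, ContDiff ℝ ∞ η → HasCompactSupport η → tsupport η ⊆ D →
    ∫ x in D, u x * fderiv ℝ η x (basisVec i) = -∫ x in D, g x * η x

open scoped Classical in
/-- The weak partial derivative `∂ᵢ u`; it is `0` by convention if there is none in `L²(D)`. -/
def weakPartial (D : Set R2) (i : Fin 2) (u : L2 D ℝ) : L2 D ℝ :=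
  if h : ∃ g, IsWeakPartial D i u g then h.choose else 0

/-- `u ∈ H¹(D)`. -/
def MemH1 (D : Set R2) (u : L2 D ℝ) : Prop :=
  ∀ i, ∃ g, IsWeakPartial D i u g

/-- `u ∈ H²(D)`. -/
def MemH2 (D : Set R2) (u : L2 D ℝ) : Prop :=
  MemH1 D u ∧ ∀ i, MemH1 D (weakPartial D i u)

/-- `g ∈ L²(∂D)` is the trace on `∂D` of `u ∈ H¹(D)`: some sequence of smooth functions tends to
`u` in `H¹(D)` while its restrictions to `∂D` tend to `g` in `L²(∂D)`. -/
def IsTrace (D : Set R2) (u : L2 D ℝ) (g : R2 → ℝ) : Prop :=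
  MemLp g 2 (bdryMeasure D) ∧ ∃ f : ℕ → R2 → ℝ, (∀ k, ContDiff ℝ ∞ (f k)) ∧
    Tendsto (fun k => eLpNorm (fun x => f k x - u x) 2 (volume.restrict D)) atTop (𝓝 0) ∧
    (∀ i, Tendsto (fun k => eLpNorm (fun x => fderiv ℝ (f k) x (basisVec i) - weakPartial D i u x) 2
      (volume.restrict D)) atTop (𝓝 0)) ∧
    Tendsto (fun k => eLpNorm (fun x => f k x - g x) 2 (bdryMeasure D)) atTop (𝓝 0)

section lemmas

variable {D : Set R2} {i : Fin 2} {u v g h : L2 D ℝ}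

lemma integrable_mul_test (u : L2 D ℝ) {η : R2 → ℝ} (hη : Continuous η)
    (hc : HasCompactSupport η) : Integrable (fun x => u x * η x) (volume.restrict D) :=
  MemLp.integrable_mul (p := 2) (q := 2) (Lp.memLp u) (hη.memLp_of_hasCompactSupport hc)

lemma continuous_partial {η : R2 → ℝ} (hη : ContDiff ℝ ∞ η) (w : R2) :
    Continuous fun x => fderiv ℝ η x w :=
  (hη.continuous_fderiv (by simp)).clm_apply continuous_const

lemma hasCompactSupport_partial {η : R2 → ℝ} (hc : HasCompactSupport η) (w : R2) :
    HasCompactSupport fun x => fderiv ℝ η x w :=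
  hc.fderiv_apply ℝ w

lemma IsWeakPartial.add (h1 : IsWeakPartial D i u g) (h2 : IsWeakPartial D i v h) :
    IsWeakPartial D i (u + v) (g + h) := by
  intro η hη hc hs
  have e1 : ∫ x in D, (u + v : L2 D ℝ) x * fderiv ℝ η x (basisVec i) =
      ∫ x in D, (u x * fderiv ℝ η x (basisVec i) + v x * fderiv ℝ η x (basisVec i)) := by
    refine integral_congr_ae ?_
    filter_upwards [Lp.coeFn_add u v] with x hx
    rw [hx, Pi.add_apply, add_mul]
  have e2 : ∫ x in D, (g + h : L2 D ℝ) x * η x = ∫ x in D, (g x * η x + h x * η x) := by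
    refine integral_congr_ae ?_
    filter_upwards [Lp.coeFn_add g h] with x hx
    rw [hx, Pi.add_apply, add_mul]
  rw [e1, e2, integral_add, integral_add, h1 η hη hc hs, h2 η hη hc hs]
  · ring
  · exact integrable_mul_test g hη.continuous hc
  · exact integrable_mul_test h hη.continuous hc
  · exact integrable_mul_test u (continuous_partial hη _) (hasCompactSupport_partial hc _)
  · exact integrable_mul_test v (continuous_partial hη _) (hasCompactSupport_partial hc _)

lemma IsWeakPartial.smul (c : ℝ) (h1 : IsWeakPartial D i u g) :
    IsWeakPartial D i (c • u) (c • g) := by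
  intro η hη hc hs
  have e1 : ∫ x in D, (c • u : L2 D ℝ) x * fderiv ℝ η x (basisVec i) =
      ∫ x in D, c * (u x * fderiv ℝ η x (basisVec i)) := by
    refine integral_congr_ae ?_
    filter_upwards [Lp.coeFn_smul c u] with x hx
    rw [hx, Pi.smul_apply, smul_eq_mul, mul_assoc]
  have e2 : ∫ x in D, (c • g : L2 D ℝ) x * η x = ∫ x in D, c * (g x * η x) := by
    refine integral_congr_ae ?_
    filter_upwards [Lp.coeFn_smul c g] with x hx
    rw [hx, Pi.smul_apply, smul_eq_mul, mul_assoc]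
  rw [e1, e2, integral_const_mul, integral_const_mul, h1 η hη hc hs]
  ring

/-- Weak derivatives on open sets are unique. -/
lemma IsWeakPartial.unique (hD : IsOpen D) (h1 : IsWeakPartial D i u g)
    (h2 : IsWeakPartial D i u h) : g = h := by
  have key : ∀ᵐ x ∂(volume.restrict D : Measure R2), x ∈ D → (g x - h x) = 0 := by
    refine hD.ae_eq_zero_of_integral_contDiff_smul_eq_zero
      (f := fun x => g x - h x) ?_ ?_
    · exact (((Lp.memLp g).sub (Lp.memLp h)).locallyIntegrable (by norm_num)).locallyIntegrableOn D
    · intro η hη hc hs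
      have e : ∀ x, η x • (g x - h x) = g x * η x - h x * η x := by
        intro x
        simp only [smul_eq_mul]
        ring
      simp only [e]
      rw [integral_sub (integrable_mul_test g hη.continuous hc)
        (integrable_mul_test h hη.continuous hc)]
      have a := h1 η hη hc hs
      have b := h2 η hη hc hs
      linarith
  refine Lp.ext ?_
  filter_upwards [key, ae_restrict_mem hD.measurableSet] with x hx hxD
  linarith [hx hxD]

lemma weakPartial_spec (hu : ∃ g, IsWeakPartial D i u g) :
    IsWeakPartial D i u (weakPartial D i u) := by
  rw [weakPartial, dif_pos hu]
  exact hu.choose_spec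

lemma IsWeakPartial.weakPartial_eq (hD : IsOpen D) (h1 : IsWeakPartial D i u g) :
    weakPartial D i u = g :=
  (weakPartial_spec ⟨g, h1⟩).unique hD h1

lemma MemH1.add (hu : MemH1 D u) (hv : MemH1 D v) : MemH1 D (u + v) := fun i =>
  ⟨_, (weakPartial_spec (hu i)).add (weakPartial_spec (hv i))⟩

lemma MemH1.smul (c : ℝ) (hu : MemH1 D u) : MemH1 D (c • u) := fun i =>
  ⟨_, (weakPartial_spec (hu i)).smul c⟩

lemma weakPartial_add (hD : IsOpen D) (hu : MemH1 D u) (hv : MemH1 D v) (i : Fin 2) :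
    weakPartial D i (u + v) = weakPartial D i u + weakPartial D i v :=
  ((weakPartial_spec (hu i)).add (weakPartial_spec (hv i))).weakPartial_eq hD

lemma weakPartial_smul (hD : IsOpen D) (c : ℝ) (hu : MemH1 D u) (i : Fin 2) :
    weakPartial D i (c • u) = c • weakPartial D i u :=
  ((weakPartial_spec (hu i)).smul c).weakPartial_eq hD

lemma MemH2.add (hD : IsOpen D) (hu : MemH2 D u) (hv : MemH2 D v) : MemH2 D (u + v) := by
  refine ⟨hu.1.add hv.1, fun i => ?_⟩
  rw [weakPartial_add hD hu.1 hv.1]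
  exact (hu.2 i).add (hv.2 i)

lemma MemH2.smul (hD : IsOpen D) (c : ℝ) (hu : MemH2 D u) : MemH2 D (c • u) := by
  refine ⟨hu.1.smul c, fun i => ?_⟩
  rw [weakPartial_smul hD c hu.1]
  exact (hu.2 i).smul c

lemma tendsto_eLpNorm_add {μ : Measure R2} {a b A B w : ℕ → R2 → ℝ}
    (ha : Tendsto (fun k => eLpNorm (fun x => a k x - A k x) 2 μ) atTop (𝓝 0))
    (hb : Tendsto (fun k => eLpNorm (fun x => b k x - B k x) 2 μ) atTop (𝓝 0))
    (hma : ∀ k, AEStronglyMeasurable (fun x => a k x - A k x) μ)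
    (hmb : ∀ k, AEStronglyMeasurable (fun x => b k x - B k x) μ)
    (hw : ∀ k, w k =ᵐ[μ] fun x => (a k x - A k x) + (b k x - B k x)) :
    Tendsto (fun k => eLpNorm (w k) 2 μ) atTop (𝓝 0) := by
  have hs := ha.add hb
  rw [add_zero] at hs
  refine tendsto_of_tendsto_of_tendsto_of_le_of_le tendsto_const_nhds hs (fun _ => zero_le) ?_
  intro k
  simp only
  rw [eLpNorm_congr_ae (hw k)]
  exact eLpNorm_add_le (hma k) (hmb k) (by norm_num)

lemma tendsto_eLpNorm_smul {μ : Measure R2} {a w : ℕ → R2 → ℝ} (c : ℝ)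
    (ha : Tendsto (fun k => eLpNorm (a k) 2 μ) atTop (𝓝 0))
    (hw : ∀ k, w k =ᵐ[μ] fun x => c * a k x) :
    Tendsto (fun k => eLpNorm (w k) 2 μ) atTop (𝓝 0) := by
  have hs := ENNReal.Tendsto.const_mul (a := ‖c‖ₑ) ha (Or.inr (by simp))
  rw [mul_zero] at hs
  refine hs.congr fun k => ?_
  rw [eLpNorm_congr_ae (hw k), ← eLpNorm_const_smul]
  rfl

lemma IsTrace.add (hD : IsOpen D) (hu : MemH1 D u) (hv : MemH1 D v) {p q : R2 → ℝ}
    (h1 : IsTrace D u p) (h2 : IsTrace D v q) : IsTrace D (u + v) (fun x => p x + q x) := by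
  obtain ⟨hp, f, hf, f1, f2, f3⟩ := h1
  obtain ⟨hq, e, he, e1, e2, e3⟩ := h2
  refine ⟨hp.add hq, fun k x => f k x + e k x, fun k => (hf k).add (he k), ?_, fun i => ?_, ?_⟩
  · refine tendsto_eLpNorm_add f1 e1 (fun k => ?_) (fun k => ?_) (fun k => ?_)
    · exact (hf k).continuous.aestronglyMeasurable.sub (Lp.aestronglyMeasurable u)
    · exact (he k).continuous.aestronglyMeasurable.sub (Lp.aestronglyMeasurable v)
    · filter_upwards [Lp.coeFn_add u v] with x hx
      rw [hx, Pi.add_apply]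
      ring
  · refine tendsto_eLpNorm_add (f2 i) (e2 i) (fun k => ?_) (fun k => ?_) (fun k => ?_)
    · exact (continuous_partial (hf k) _).aestronglyMeasurable.sub (Lp.aestronglyMeasurable _)
    · exact (continuous_partial (he k) _).aestronglyMeasurable.sub (Lp.aestronglyMeasurable _)
    · rw [weakPartial_add hD hu hv i]
      filter_upwards [Lp.coeFn_add (weakPartial D i u) (weakPartial D i v)] with x hx
      have : fderiv ℝ (fun x => f k x + e k x) x = fderiv ℝ (f k) x + fderiv ℝ (e k) x :=
        fderiv_add ((hf k).differentiable (by simp) x) ((he k).differentiable (by simp) x)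
      rw [hx, Pi.add_apply, this, add_apply]
      ring
  · refine tendsto_eLpNorm_add f3 e3 (fun k => ?_) (fun k => ?_) (fun k => ?_)
    · exact (hf k).continuous.aestronglyMeasurable.sub hp.1
    · exact (he k).continuous.aestronglyMeasurable.sub hq.1
    · filter_upwards with x
      ring

lemma IsTrace.smul (hD : IsOpen D) (c : ℝ) (hu : MemH1 D u) {p : R2 → ℝ}
    (h1 : IsTrace D u p) : IsTrace D (c • u) (fun x => c * p x) := by
  obtain ⟨hp, f, hf, f1, f2, f3⟩ := h1
  refine ⟨hp.const_mul c, fun k x => c * f k x, fun k => contDiff_const.mul (hf k), ?_,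
    fun i => ?_, ?_⟩
  · refine tendsto_eLpNorm_smul c f1 fun k => ?_
    filter_upwards [Lp.coeFn_smul c u] with x hx
    rw [hx, Pi.smul_apply, smul_eq_mul]
    ring
  · refine tendsto_eLpNorm_smul c (f2 i) fun k => ?_
    rw [weakPartial_smul hD c hu i]
    filter_upwards [Lp.coeFn_smul c (weakPartial D i u)] with x hx
    have : fderiv ℝ (fun x => c * f k x) x = c • fderiv ℝ (f k) x :=
      fderiv_const_mul ((hf k).differentiable (by simp) x) c
    rw [hx, Pi.smul_apply, this, smul_apply, smul_eq_mul, smul_eq_mul]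
    ring
  · refine tendsto_eLpNorm_smul c f3 fun k => ?_
    filter_upwards with x
    ring

lemma isWeakPartial_zero : IsWeakPartial D i 0 0 := by
  have e : ∀ f : R2 → ℝ, ∫ x in D, (0 : L2 D ℝ) x * f x = 0 := by
    intro f
    refine integral_eq_zero_of_ae ?_
    filter_upwards [Lp.coeFn_zero ℝ 2 (volume.restrict D : Measure R2)] with x hx
    rw [hx]
    simp
  intro η _ _ _
  rw [e, e, neg_zero]

lemma memH1_zero : MemH1 D 0 := fun _ => ⟨0, isWeakPartial_zero⟩

lemma weakPartial_zero (hD : IsOpen D) : weakPartial D i 0 = 0 :=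
  isWeakPartial_zero.weakPartial_eq hD

lemma isTrace_zero (hD : IsOpen D) : IsTrace D 0 (fun _ => 0) := by
  have e : (fun x => (0 : ℝ) - (0 : L2 D ℝ) x) =ᵐ[volume.restrict D] 0 := by
    filter_upwards [Lp.coeFn_zero ℝ 2 (volume.restrict D : Measure R2)] with x hx
    rw [hx]
    simp
  refine ⟨MemLp.zero, fun _ _ => 0, fun _ => contDiff_const, ?_, fun i => ?_, ?_⟩
  · simp only [eLpNorm_congr_ae e, eLpNorm_zero]
    exact tendsto_const_nhds
  · rw [weakPartial_zero hD]
    simp only [fderiv_fun_const, Pi.zero_apply, zero_apply,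
      eLpNorm_congr_ae e, eLpNorm_zero]
    exact tendsto_const_nhds
  · simp

end lemmas

/-! ### Fields on one plate -/

/-- Displacements `(v, v₃) ∈ L²(D; ℝ²) × L²(D)` of a plate, in-plane and out-of-plane part. -/
abbrev PlateV (D : Set R2) : Type := WithLp 2 (L2 D R2 × L2 D ℝ)

/-- Pairs `(τ, κ)` of symmetric tensor fields in `L²(D; 𝕊) × L²(D; 𝕊)`. -/
abbrev PlateS (D : Set R2) : Type := WithLp 2 (L2 D Sym × L2 D Sym)

/-- The component `vᵢ` of a vector field. -/
def comp {D : Set R2} (i : Fin 2) (v : L2 D R2) : L2 D ℝ :=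
  (EuclideanSpace.proj i : R2 →L[ℝ] ℝ).compLpL 2 (volume.restrict D) v

/-- The tensor field `x ↦ f x • A`. -/
def smulField {D : Set R2} (A : Sym) (f : L2 D ℝ) : L2 D Sym :=
  (ContinuousLinearMap.toSpanSingleton ℝ A).compLpL 2 (volume.restrict D) f

/-- The symmetric gradient `∇ˢv`, with entries `(∂ⱼ vᵢ + ∂ᵢ vⱼ) / 2`. -/
def symGrad (D : Set R2) (v : L2 D R2) : L2 D Sym :=
  ∑ i, ∑ j, smulField (symUnit i j) (weakPartial D j (comp i v))

/-- The Hessian `∇²w`, with entries `∂ⱼ∂ᵢ w` (weak second derivatives commute). -/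
def hess (D : Set R2) (w : L2 D ℝ) : L2 D Sym :=
  ∑ i, ∑ j, smulField (symUnit i j) (weakPartial D j (weakPartial D i w))

/-- `(v, v₃) ∈ H¹(D; ℝ²) × H²(D)`. -/
def MemPlateH (D : Set R2) (p : PlateV D) : Prop :=
  (∀ i, MemH1 D (comp i p.fst)) ∧ MemH2 D p.snd

/-- `g`, `g₃`, `s` are the boundary traces of `v`, `v₃` and `∇v₃`. -/
def IsPlateTrace (D : Set R2) (p : PlateV D) (g : R2 → R2) (g₃ : R2 → ℝ) (s : R2 → R2) : Prop :=
  (∀ i, IsTrace D (comp i p.fst) (fun x => g x i)) ∧ IsTrace D p.snd g₃ ∧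
    ∀ i, IsTrace D (weakPartial D i p.snd) (fun x => s x i)

/-- The operator `(v, v₃) ↦ (-∇ˢv, ∇²v₃)` of one plate. -/
def plateB (D : Set R2) (p : PlateV D) : PlateS D :=
  WithLp.toLp 2 (-symGrad D p.fst, hess D p.snd)

section lemmas

variable {D : Set R2} {p q : PlateV D}

lemma comp_add (i : Fin 2) (v w : L2 D R2) : comp i (v + w) = comp i v + comp i w :=
  map_add _ _ _

lemma comp_smul (i : Fin 2) (c : ℝ) (v : L2 D R2) : comp i (c • v) = c • comp i v :=
  map_smul _ _ _

lemma comp_zero (i : Fin 2) : comp i (0 : L2 D R2) = 0 := map_zero _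

lemma MemPlateH.add (hD : IsOpen D) (hp : MemPlateH D p) (hq : MemPlateH D q) :
    MemPlateH D (p + q) := by
  refine ⟨fun i => ?_, hp.2.add hD hq.2⟩
  rw [WithLp.add_fst, comp_add]
  exact (hp.1 i).add (hq.1 i)

lemma MemPlateH.smul (hD : IsOpen D) (c : ℝ) (hp : MemPlateH D p) : MemPlateH D (c • p) := by
  refine ⟨fun i => ?_, hp.2.smul hD c⟩
  rw [WithLp.smul_fst, comp_smul]
  exact (hp.1 i).smul c

lemma memPlateH_zero (hD : IsOpen D) : MemPlateH D 0 := by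
  refine ⟨fun i => ?_, memH1_zero, fun i => ?_⟩
  · rw [WithLp.zero_fst, comp_zero]
    exact memH1_zero
  · rw [WithLp.zero_snd, weakPartial_zero hD]
    exact memH1_zero

lemma IsPlateTrace.add (hD : IsOpen D) (hp : MemPlateH D p) (hq : MemPlateH D q)
    {g g' s s' : R2 → R2} {w w' : R2 → ℝ} (h1 : IsPlateTrace D p g w s)
    (h2 : IsPlateTrace D q g' w' s') :
    IsPlateTrace D (p + q) (fun x => g x + g' x) (fun x => w x + w' x) (fun x => s x + s' x) := by
  refine ⟨fun i => ?_, h1.2.1.add hD hp.2.1 hq.2.1 h2.2.1, fun i => ?_⟩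
  · rw [WithLp.add_fst, comp_add]
    exact (h1.1 i).add hD (hp.1 i) (hq.1 i) (h2.1 i)
  · rw [WithLp.add_snd, weakPartial_add hD hp.2.1 hq.2.1]
    exact (h1.2.2 i).add hD (hp.2.2 i) (hq.2.2 i) (h2.2.2 i)

lemma IsPlateTrace.smul (hD : IsOpen D) (c : ℝ) (hp : MemPlateH D p)
    {g s : R2 → R2} {w : R2 → ℝ} (h1 : IsPlateTrace D p g w s) :
    IsPlateTrace D (c • p) (fun x => c • g x) (fun x => c * w x) (fun x => c • s x) := by
  refine ⟨fun i => ?_, h1.2.1.smul hD c hp.2.1, fun i => ?_⟩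
  · rw [WithLp.smul_fst, comp_smul]
    exact (h1.1 i).smul hD c (hp.1 i)
  · rw [WithLp.smul_snd, weakPartial_smul hD c hp.2.1]
    exact (h1.2.2 i).smul hD c (hp.2.2 i)

lemma isPlateTrace_zero (hD : IsOpen D) :
    IsPlateTrace D 0 (fun _ => 0) (fun _ => 0) (fun _ => 0) := by
  refine ⟨fun i => ?_, isTrace_zero hD, fun i => ?_⟩
  · rw [WithLp.zero_fst, comp_zero]
    exact isTrace_zero hD
  · rw [WithLp.zero_snd, weakPartial_zero hD]
    exact isTrace_zero hD

lemma symGrad_add (hD : IsOpen D) (hp : MemPlateH D p) (hq : MemPlateH D q) :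
    symGrad D (p + q).fst = symGrad D p.fst + symGrad D q.fst := by
  simp only [symGrad, ← Finset.sum_add_distrib]
  refine Finset.sum_congr rfl fun i _ => Finset.sum_congr rfl fun j _ => ?_
  rw [WithLp.add_fst, comp_add, weakPartial_add hD (hp.1 i) (hq.1 i)]
  exact map_add _ _ _

lemma symGrad_smul (hD : IsOpen D) (c : ℝ) (hp : MemPlateH D p) :
    symGrad D (c • p).fst = c • symGrad D p.fst := by
  simp only [symGrad, Finset.smul_sum]
  refine Finset.sum_congr rfl fun i _ => Finset.sum_congr rfl fun j _ => ?_
  rw [WithLp.smul_fst, comp_smul, weakPartial_smul hD c (hp.1 i)]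
  exact map_smul _ _ _

lemma hess_add (hD : IsOpen D) (hp : MemPlateH D p) (hq : MemPlateH D q) :
    hess D (p + q).snd = hess D p.snd + hess D q.snd := by
  simp only [hess, ← Finset.sum_add_distrib]
  refine Finset.sum_congr rfl fun i _ => Finset.sum_congr rfl fun j _ => ?_
  rw [WithLp.add_snd, weakPartial_add hD hp.2.1 hq.2.1, weakPartial_add hD (hp.2.2 i) (hq.2.2 i)]
  exact map_add _ _ _

lemma hess_smul (hD : IsOpen D) (c : ℝ) (hp : MemPlateH D p) :
    hess D (c • p).snd = c • hess D p.snd := by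
  simp only [hess, Finset.smul_sum]
  refine Finset.sum_congr rfl fun i _ => Finset.sum_congr rfl fun j _ => ?_
  rw [WithLp.smul_snd, weakPartial_smul hD c hp.2.1, weakPartial_smul hD c (hp.2.2 i)]
  exact map_smul _ _ _

lemma plateB_add (hD : IsOpen D) (hp : MemPlateH D p) (hq : MemPlateH D q) :
    plateB D (p + q) = plateB D p + plateB D q := by
  rw [plateB, symGrad_add hD hp hq, hess_add hD hp hq, neg_add]
  rfl

lemma plateB_smul (hD : IsOpen D) (c : ℝ) (hp : MemPlateH D p) :
    plateB D (c • p) = c • plateB D p := by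
  rw [plateB, symGrad_smul hD c hp, hess_smul hD c hp, ← smul_neg]
  rfl

end lemmas

/-! ### Material law -/

/-- Thickness, Young's modulus and Poisson ratio, common to both plates. -/
structure Material where
  /-- thickness -/
  e : ℝ
  /-- Young's modulus -/
  E : ℝ
  /-- Poisson ratio -/
  ν : ℝ
  e_pos : 0 < e
  E_pos : 0 < E
  neg_one_lt_ν : -1 < ν
  ν_lt_one : ν < 1

/-- `A ↦ c ((1 - ν) A + ν tr(A) I)`. -/
def isotropic (c ν : ℝ) : Sym →L[ℝ] Sym :=
  c • ((1 - ν) • ContinuousLinearMap.id ℝ Sym + ν • symTrace.smulRight symOne)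

/-- The in-plane tensor, `N = C₁ e`. -/
def Material.C₁ (m : Material) : Sym →L[ℝ] Sym :=
  isotropic (m.E * m.e / (1 - m.ν ^ 2)) m.ν

/-- The bending tensor, `M = C₂ K`. -/
def Material.C₂ (m : Material) : Sym →L[ℝ] Sym :=
  isotropic (m.E * m.e ^ 3 / (12 * (1 - m.ν ^ 2))) m.ν

/-- Pointwise application of a linear map of tensors to a tensor field. -/
def applyField {D : Set R2} (L : Sym →L[ℝ] Sym) (τ : L2 D Sym) : L2 D Sym :=
  L.compLpL 2 (volume.restrict D) τ

/-! ### Two coupled plates -/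

/-- The configuration of two plates that are joined along a straight segment. -/
structure CoupledPlates where
  /-- mid-surface of the first plate, in coordinates of its own plane -/
  S : Set R2
  /-- mid-surface of the second plate, in coordinates of its own plane -/
  S' : Set R2
  /-- position of the plane of the first plate in space -/
  pos : R2 →ᵃⁱ[ℝ] R3
  /-- position of the plane of the second plate in space -/
  pos' : R2 →ᵃⁱ[ℝ] R3
  /-- end points of the junction -/
  a : R3
  b : R3
  /-- the outer normal of the first plate on the junction -/
  n : R2
  /-- the outer normal of the second plate on the junction -/
  n' : R2
  /-- the angle of the plates -/
  θ : ℝ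
  /-- the clamped part `∂S₀` of the boundary of the first plate -/
  clamped : Set R2
  domain : IsLipschitzDomain S
  domain' : IsLipschitzDomain S'
  a_ne_b : a ≠ b
  junction_eq : pos '' frontier S ∩ pos' '' frontier S' = segment ℝ a b
  normal : ∀ x, pos x ∈ openSegment ℝ a b → IsOuterUnitNormal S x n
  normal' : ∀ x, pos' x ∈ openSegment ℝ a b → IsOuterUnitNormal S' x n'
  θ_pos : 0 < θ
  θ_lt_pi : θ < Real.pi
  /-- With the frame `n`, `t = rot n`, `l = n × t` of the first plate in space, the outer normal
  of the second plate is `cos θ n - sin θ l`. -/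
  frame_normal : pos'.linear n' =
    Real.cos θ • pos.linear n - Real.sin θ • cross (pos.linear n) (pos.linear (rot n))
  /-- The tangents `rot n` and `rot n'` of the two plates are opposite to each other. -/
  frame_tangent : pos'.linear (rot n') = -pos.linear (rot n)
  clamped_subset : clamped ⊆ frontier S
  clamped_measurable : MeasurableSet clamped
  clamped_pos : Measure.hausdorffMeasure 1 clamped ≠ 0
  clamped_junction : Measure.hausdorffMeasure 1 (clamped ∩ pos ⁻¹' segment ℝ a b) = 0

namespace CoupledPlates

variable (P : CoupledPlates)

/-- The junction `Γ`, in coordinates of the plane of the first plate. -/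
def junction : Set R2 := P.pos ⁻¹' segment ℝ P.a P.b

/-- The space `V = L²(S; ℝ²) × L²(S) × L²(S'; ℝ²) × L²(S')`. -/
abbrev V : Type := WithLp 2 (PlateV P.S × PlateV P.S')

/-- The space of quadruples of square integrable symmetric tensor fields. -/
abbrev StressL2 : Type := WithLp 2 (PlateS P.S × PlateS P.S')

/-- The conditions `v = 0`, `v₃ = 0`, `∂ₙ v₃ = 0` on the clamped part, in terms of the traces of
`v`, `v₃` and `∇v₃`. -/
def Clamped (g : R2 → R2) (g₃ : R2 → ℝ) (s : R2 → R2) : Prop :=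
  ∀ᵐ x ∂(Measure.hausdorffMeasure 1 : Measure R2).restrict P.clamped,
    g x = 0 ∧ g₃ x = 0 ∧ ∀ n, IsOuterUnitNormal P.S x n → inner ℝ (s x) n = 0

/-- The kinematic conditions on the junction, in terms of the traces of both plates; here `x` and
`x'` are the coordinates of the same point of the junction in the planes of the two plates, and the
in-plane components on the junction refer to the frames `(n, t)` and `(n', t')`. -/
def Joined (g : R2 → R2) (g₃ : R2 → ℝ) (s : R2 → R2)
    (g' : R2 → R2) (g₃' : R2 → ℝ) (s' : R2 → R2) : Prop :=
  ∀ᵐ x ∂(Measure.hausdorffMeasure 1 : Measure R2).restrict P.junction,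
    ∀ x', P.pos' x' = P.pos x →
      inner ℝ (s x) P.n = -inner ℝ (s' x') P.n' ∧
      inner ℝ (g x) P.n = inner ℝ (g' x') P.n' * Real.cos P.θ - g₃' x' * Real.sin P.θ ∧
      inner ℝ (g x) (rot P.n) = -inner ℝ (g' x') (rot P.n') ∧
      g₃ x = -(inner ℝ (g' x') P.n' * Real.sin P.θ) - g₃' x' * Real.cos P.θ

/-- The space `W` of kinematically admissible displacements. -/
def W : Submodule ℝ P.V where
  carrier := {ψ | MemPlateH P.S ψ.fst ∧ MemPlateH P.S' ψ.snd ∧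
    ∃ g g₃ s g' g₃' s', IsPlateTrace P.S ψ.fst g g₃ s ∧ IsPlateTrace P.S' ψ.snd g' g₃' s' ∧
      P.Clamped g g₃ s ∧ P.Joined g g₃ s g' g₃' s'}
  add_mem' := by
    rintro ψ χ ⟨h1, h2, g, w, s, g', w', s', t1, t2, c, j⟩
      ⟨k1, k2, G, w2, s2, G', w2', s2', T1, T2, C, J⟩
    have hS := P.domain.isOpen
    have hS' := P.domain'.isOpen
    refine ⟨h1.add hS k1, h2.add hS' k2, _, _, _, _, _, _, t1.add hS h1 k1 T1,
      t2.add hS' h2 k2 T2, ?_, ?_⟩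
    · filter_upwards [c, C] with x hx hX
      refine ⟨by rw [hx.1, hX.1, add_zero], by rw [hx.2.1, hX.2.1, add_zero], fun n hn => ?_⟩
      rw [inner_add_left, hx.2.2 n hn, hX.2.2 n hn, add_zero]
    · filter_upwards [j, J] with x hx hX x' e
      obtain ⟨a1, a2, a3, a4⟩ := hx x' e
      obtain ⟨b1, b2, b3, b4⟩ := hX x' e
      simp only [inner_add_left]
      exact ⟨by linarith, by linarith, by linarith, by linarith⟩
  zero_mem' := by
    have hS := P.domain.isOpen
    have hS' := P.domain'.isOpen
    refine ⟨memPlateH_zero hS, memPlateH_zero hS', _, _, _, _, _, _, isPlateTrace_zero hS,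
      isPlateTrace_zero hS', ?_, ?_⟩
    · exact Eventually.of_forall fun x => ⟨rfl, rfl, fun n _ => inner_zero_left n⟩
    · exact Eventually.of_forall fun x x' _ => by simp
  smul_mem' := by
    rintro r ψ ⟨h1, h2, g, w, s, g', w', s', t1, t2, c, j⟩
    have hS := P.domain.isOpen
    have hS' := P.domain'.isOpen
    refine ⟨h1.smul hS r, h2.smul hS' r, _, _, _, _, _, _, t1.smul hS r h1,
      t2.smul hS' r h2, ?_, ?_⟩
    · filter_upwards [c] with x hx
      refine ⟨by rw [hx.1, smul_zero], by rw [hx.2.1, mul_zero], fun n hn => ?_⟩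
      rw [real_inner_smul_left, hx.2.2 n hn, mul_zero]
    · filter_upwards [j] with x hx x' e
      obtain ⟨a1, a2, a3, a4⟩ := hx x' e
      simp only [real_inner_smul_left, a1, a2, a3, a4]
      exact ⟨by ring, by ring, by ring, by ring⟩

/-- The operator `B = (-∇ˢ, ∇²; -∇ˢ, ∇²)` on `W`. -/
def B : P.W →ₗ[ℝ] P.StressL2 where
  toFun := fun ψ => WithLp.toLp 2 (plateB P.S ψ.1.fst, plateB P.S' ψ.1.snd)
  map_add' := by
    rintro ⟨ψ, h⟩ ⟨χ, k⟩
    simp only [Submodule.coe_add, WithLp.add_fst, WithLp.add_snd,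
      plateB_add P.domain.isOpen h.1 k.1, plateB_add P.domain'.isOpen h.2.1 k.2.1]
    rfl
  map_smul' := by
    rintro c ⟨ψ, h⟩
    simp only [Submodule.coe_smul, WithLp.smul_fst, WithLp.smul_snd,
      plateB_smul P.domain.isOpen c h.1, plateB_smul P.domain'.isOpen c h.2.1]
    rfl

/-- The adjoint `B*` of `B`, where `B` is regarded as an unbounded operator from `V` with domain
`W`. (`W` contains all smooth displacements with compact support in the open mid-surfaces, so that
it is dense in `V`.) -/
def Bstar : P.StressL2 →ₗ.[ℝ] P.V :=
  LinearPMap.adjoint (𝕜 := ℝ) (E := P.V) (F := P.StressL2) ⟨P.W, P.B⟩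

/-- The space `Σ = D(B*)`. -/
abbrev Sig : Submodule ℝ P.StressL2 := P.Bstar.domain

/-- `C = (C₁, C₂; C₁, C₂)`. -/
def C (m : Material) (Ψ : P.StressL2) : P.StressL2 :=
  WithLp.toLp 2
    (WithLp.toLp 2 (applyField m.C₁ Ψ.fst.fst, applyField m.C₂ Ψ.fst.snd),
     WithLp.toLp 2 (applyField m.C₁ Ψ.snd.fst, applyField m.C₂ Ψ.snd.snd))

/-- The bilinear form `(Φ, Ψ)_{C⁻¹}`. -/
def formCinv (m : Material) (Φ Ψ : P.StressL2) : ℝ :=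
  inner ℝ (applyField m.C₁.inverse Φ.fst.fst) Ψ.fst.fst +
  inner ℝ (applyField m.C₂.inverse Φ.fst.snd) Ψ.fst.snd +
  inner ℝ (applyField m.C₁.inverse Φ.snd.fst) Ψ.snd.fst +
  inner ℝ (applyField m.C₂.inverse Φ.snd.snd) Ψ.snd.snd

/-- The form `D(φ, ψ) = ∫ N(u) : e(v) + ∫ M(u₃) : K(v₃)`, summed over both plates, with
`e(v) = ∇ˢv`, `N(u) = C₁ e(u)`, `K(v₃) = -∇²v₃`, `M(u₃) = C₂ K(u₃)`. -/
def formD (m : Material) (φ ψ : P.W) : ℝ :=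
  inner ℝ (applyField m.C₁ (symGrad P.S φ.1.fst.fst)) (symGrad P.S ψ.1.fst.fst) +
  inner ℝ (applyField m.C₂ (-hess P.S φ.1.fst.snd)) (-hess P.S ψ.1.fst.snd) +
  inner ℝ (applyField m.C₁ (symGrad P.S' φ.1.snd.fst)) (symGrad P.S' ψ.1.snd.fst) +
  inner ℝ (applyField m.C₂ (-hess P.S' φ.1.snd.snd)) (-hess P.S' ψ.1.snd.snd)

/-- `φ` solves the displacement problem with load `F`. -/
def SolvesDisplacement (m : Material) (F : P.V) (φ : P.W) : Prop :=
  ∀ ψ : P.W, P.formD m φ ψ = inner ℝ F (ψ : P.V)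

/-- `(Φ, φ) ∈ Σ × V` solves the mixed problem with load `F`. -/
def SolvesMixed (m : Material) (F : P.V) (Φ : P.Sig) (φ : P.V) : Prop :=
  (∀ Ψ : P.Sig, P.formCinv m Φ Ψ + inner ℝ (P.Bstar Ψ) φ = 0) ∧
  ∀ ψ : P.V, inner ℝ (P.Bstar Φ) ψ = -inner ℝ F ψ

end CoupledPlates

end Plates

end

/-!
The displacement problem says precisely that `-F` represents the functional
`ψ ↦ (B ψ, Φ)` on `W` for `Φ = -C B φ`, because `D(φ, ψ) = (C B φ, B ψ)`. This puts `Φ` in the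
domain of `B*`, and `B* Φ = -F` as soon as `W` is dense in `V`. The other equation of the mixed
problem is the defining identity of the adjoint, `(B* Ψ, φ) = (Ψ, B φ)`, together with
`C⁻¹ Φ = -B φ`.

Two facts carry this. The material tensors are invertible (`isotropic_isInvertible`), so that
`ContinuousLinearMap.inverse` in the form `(·, ·)_{C⁻¹}` is the true inverse. And `W` is dense in
`V` (`dense_W`): `W` contains the displacements with one component a test function on one of the
mid-surfaces and all others zero, since for these all boundary traces vanish, so that a vector
orthogonal to `W` is zero by the fundamental lemma of the calculus of variations.
-/

noncomputable section

namespace Plates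

/-! ### Invertibility of the material law -/

lemma symTrace_symOne : symTrace symOne = 2 := by
  have h : ∀ i j : Fin 2, symIncl symOne (i, j) = if i = j then 1 else 0 := by
    intro i j
    change ((1 / 2 : ℝ) • (EuclideanSpace.single ((0 : Fin 2), (0 : Fin 2)) (1 : ℝ) +
      EuclideanSpace.single (0, 0) 1) + (1 / 2 : ℝ) • (EuclideanSpace.single (1, 1) 1 +
      EuclideanSpace.single (1, 1) 1) : EuclideanSpace ℝ (Fin 2 × Fin 2)) (i, j) = _
    fin_cases i <;> fin_cases j <;> norm_num [PiLp.add_apply, PiLp.smul_apply]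
  change symIncl symOne (0, 0) + symIncl symOne (1, 1) = 2
  rw [h, h]
  norm_num

lemma isotropic_apply (c ν : ℝ) (A : Sym) :
    isotropic c ν A = c • ((1 - ν) • A + ν • symTrace A • symOne) := rfl

/-- `isotropic c ν` acts on trace-free matrices as `c (1 - ν)` and on multiples of the identity as
`c (1 + ν)`; the inverse has the reciprocal factors. -/
lemma isotropic_isInvertible {c ν : ℝ} (hc : c ≠ 0) (h1 : 1 - ν ≠ 0) (h2 : 1 + ν ≠ 0) :
    (isotropic c ν).IsInvertible := by
  let g : Sym →L[ℝ] Sym := (c⁻¹ * (1 - ν)⁻¹) •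
    (ContinuousLinearMap.id ℝ Sym - (ν / (1 + ν)) • symTrace.smulRight symOne)
  have hg : ∀ A, g A = (c⁻¹ * (1 - ν)⁻¹) • (A - (ν / (1 + ν)) • symTrace A • symOne) :=
    fun A => rfl
  refine ⟨ContinuousLinearEquiv.equivOfInverse (isotropic c ν) g (fun A => ?_) (fun A => ?_), rfl⟩
  · simp only [hg, isotropic_apply, map_add, map_smul, symTrace_symOne, smul_eq_mul]
    match_scalars <;> field_simp
    ring
  · simp only [hg, isotropic_apply, map_sub, map_smul, symTrace_symOne]
    match_scalars <;> field_simp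
    ring

lemma Material.one_sub_sq_pos (m : Material) : 0 < 1 - m.ν ^ 2 := by
  nlinarith [m.neg_one_lt_ν, m.ν_lt_one]

lemma Material.isotropic_isInvertible (m : Material) {c : ℝ} (hc : c ≠ 0) :
    (isotropic c m.ν).IsInvertible :=
  Plates.isotropic_isInvertible hc (by linarith [m.ν_lt_one]) (by linarith [m.neg_one_lt_ν])

lemma Material.C₁_isInvertible (m : Material) : m.C₁.IsInvertible :=
  m.isotropic_isInvertible
    (div_pos (mul_pos m.E_pos m.e_pos) m.one_sub_sq_pos).ne'

lemma Material.C₂_isInvertible (m : Material) : m.C₂.IsInvertible :=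
  m.isotropic_isInvertible
    (div_pos (mul_pos m.E_pos (pow_pos m.e_pos 3)) (mul_pos (by norm_num) m.one_sub_sq_pos)).ne'

section applyField

variable {D : Set R2}

lemma applyField_neg (L : Sym →L[ℝ] Sym) (τ : L2 D Sym) :
    applyField L (-τ) = -applyField L τ := map_neg _ _

lemma applyField_inverse_apply {L : Sym →L[ℝ] Sym} (hL : L.IsInvertible) (τ : L2 D Sym) :
    applyField L.inverse (applyField L τ) = τ := by
  refine Lp.ext ?_
  filter_upwards [L.inverse.coeFn_compLpL (applyField L τ), L.coeFn_compLpL τ] with x h1 h2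
  refine h1.trans ?_
  change L.inverse (applyField L τ x) = τ x
  rw [show applyField L τ x = L (τ x) from h2]
  exact hL.inverse_apply_self (τ x)

end applyField

/-! ### Test functions as elements of the Sobolev spaces -/

/-- Smooth functions whose support is compact and contained in `D`. -/
structure IsTest (D : Set R2) (η : R2 → ℝ) : Prop where
  contDiff : ContDiff ℝ ∞ η
  hasCompactSupport : HasCompactSupport η
  tsupport_subset : tsupport η ⊆ D

namespace IsTest

variable {D : Set R2} {η : R2 → ℝ}

lemma memLp (h : IsTest D η) : MemLp η 2 ((volume : Measure R2).restrict D) :=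
  h.contDiff.continuous.memLp_of_hasCompactSupport h.hasCompactSupport

/-- The class of a test function in `L²(D)`. -/
def toL2 (h : IsTest D η) : L2 D ℝ := h.memLp.toLp η

lemma coeFn_toL2 (h : IsTest D η) : h.toL2 =ᵐ[volume.restrict D] η := h.memLp.coeFn_toLp

lemma pderiv (h : IsTest D η) (i : Fin 2) : IsTest D fun x => fderiv ℝ η x (basisVec i) where
  contDiff := (h.contDiff.fderiv_right (m := ∞) (by simp)).clm_apply contDiff_const
  hasCompactSupport := hasCompactSupport_partial h.hasCompactSupport _
  tsupport_subset := (tsupport_fderiv_apply_subset ℝ _).trans h.tsupport_subset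

lemma eq_zero_of_notMem (h : IsTest D η) {x : R2} (hx : x ∉ D) : η x = 0 :=
  image_eq_zero_of_notMem_tsupport fun hx' => hx (h.tsupport_subset hx')

lemma isWeakPartial (h : IsTest D η) (i : Fin 2) :
    IsWeakPartial D i h.toL2 (h.pderiv i).toL2 := by
  intro χ hχ hc _
  have e1 : ∫ x in D, h.toL2 x * fderiv ℝ χ x (basisVec i) =
      ∫ x, η x * fderiv ℝ χ x (basisVec i) := by
    rw [← setIntegral_eq_integral_of_forall_compl_eq_zero (s := D)
      (f := fun x => η x * fderiv ℝ χ x (basisVec i))]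
    · refine integral_congr_ae ?_
      filter_upwards [h.coeFn_toL2] with x hx
      rw [hx]
    · intro x hx
      rw [h.eq_zero_of_notMem hx, zero_mul]
  have e2 : ∫ x in D, (h.pderiv i).toL2 x * χ x = ∫ x, fderiv ℝ η x (basisVec i) * χ x := by
    rw [← setIntegral_eq_integral_of_forall_compl_eq_zero (s := D)
      (f := fun x => fderiv ℝ η x (basisVec i) * χ x)]
    · refine integral_congr_ae ?_
      filter_upwards [(h.pderiv i).coeFn_toL2] with x hx
      rw [hx]
    · intro x hx
      rw [(h.pderiv i).eq_zero_of_notMem hx, zero_mul]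
  rw [e1, e2]
  have cη := h.contDiff.continuous
  have cη' := (h.pderiv i).contDiff.continuous
  refine integral_mul_fderiv_eq_neg_fderiv_mul_of_integrable ?_ ?_ ?_
    (fun x _ => h.contDiff.differentiable (by simp) x) (fun x _ => hχ.differentiable (by simp) x)
  · exact (cη'.mul hχ.continuous).integrable_of_hasCompactSupport hc.mul_left
  · exact (cη.mul (continuous_partial hχ _)).integrable_of_hasCompactSupport
      (hasCompactSupport_partial hc _).mul_left
  · exact (cη.mul hχ.continuous).integrable_of_hasCompactSupport hc.mul_left

lemma memH1 (h : IsTest D η) : MemH1 D h.toL2 := fun i => ⟨_, h.isWeakPartial i⟩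

lemma weakPartial_toL2 (hD : IsOpen D) (h : IsTest D η) (i : Fin 2) :
    weakPartial D i h.toL2 = (h.pderiv i).toL2 :=
  (h.isWeakPartial i).weakPartial_eq hD

lemma memH2 (hD : IsOpen D) (h : IsTest D η) : MemH2 D h.toL2 := by
  refine ⟨h.memH1, fun i => ?_⟩
  rw [h.weakPartial_toL2 hD]
  exact (h.pderiv i).memH1

/-- The trace of a test function vanishes: the function itself is an approximating sequence, and
it is zero on the boundary of the open set `D`. -/
lemma isTrace_zero (hD : IsOpen D) (h : IsTest D η) : IsTrace D h.toL2 fun _ => 0 := by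
  have key : ∀ {χ : R2 → ℝ} (k : IsTest D χ),
      eLpNorm (fun x => χ x - k.toL2 x) 2 (volume.restrict D) = 0 := by
    intro χ k
    refine (eLpNorm_congr_ae (g := 0) ?_).trans eLpNorm_zero
    filter_upwards [k.coeFn_toL2] with x hx
    rw [hx, sub_self, Pi.zero_apply]
  refine ⟨MemLp.zero, fun _ => η, fun _ => h.contDiff, ?_, fun i => ?_, ?_⟩
  · simp only [key h]
    exact tendsto_const_nhds
  · simp only [h.weakPartial_toL2 hD, key (h.pderiv i)]
    exact tendsto_const_nhds
  · have e : eLpNorm (fun x => η x - 0) 2 (bdryMeasure D) = 0 := by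
      refine (eLpNorm_congr_ae (g := 0) ?_).trans eLpNorm_zero
      filter_upwards [ae_restrict_mem isClosed_frontier.measurableSet] with x hx
      rw [hD.frontier_eq] at hx
      rw [h.eq_zero_of_notMem hx.2, sub_zero, Pi.zero_apply]
    simp only [e]
    exact tendsto_const_nhds

end IsTest

/-- The fundamental lemma of the calculus of variations in `L²(D)`. -/
lemma eq_zero_of_inner_test_eq_zero {D : Set R2} (hD : IsOpen D) {u : L2 D ℝ}
    (hu : ∀ (η : R2 → ℝ) (h : IsTest D η), inner ℝ h.toL2 u = 0) : u = 0 := by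
  have key : ∀ᵐ x ∂(volume.restrict D : Measure R2), x ∈ D → u x = 0 := by
    refine hD.ae_eq_zero_of_integral_contDiff_smul_eq_zero
      (((Lp.memLp u).locallyIntegrable (by norm_num)).locallyIntegrableOn D) ?_
    intro η hη hc hs
    have h : IsTest D η := ⟨hη, hc, hs⟩
    rw [← hu η h, L2.inner_def]
    refine integral_congr_ae ?_
    filter_upwards [h.coeFn_toL2] with x hx
    simp [hx, mul_comm]
  refine Lp.ext ?_
  filter_upwards [key, ae_restrict_mem hD.measurableSet,
    Lp.coeFn_zero ℝ 2 (volume.restrict D : Measure R2)] with x hx hxD h0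
  rw [hx hxD, h0, Pi.zero_apply]

/-! ### Test displacements of one plate -/

section TestDisplacements

variable {D : Set R2}

/-- The vector field with `i`-th component `f` and the other component zero. -/
def axisField (i : Fin 2) (f : L2 D ℝ) : L2 D R2 :=
  (ContinuousLinearMap.toSpanSingleton ℝ (basisVec i)).compLpL 2 (volume.restrict D) f

lemma coeFn_axisField (i : Fin 2) (f : L2 D ℝ) :
    axisField i f =ᵐ[volume.restrict D] fun x => f x • basisVec i :=
  (ContinuousLinearMap.toSpanSingleton ℝ (basisVec i)).coeFn_compLpL f

lemma coeFn_comp (i : Fin 2) (v : L2 D R2) :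
    comp i v =ᵐ[volume.restrict D] fun x => v x i :=
  (EuclideanSpace.proj i : R2 →L[ℝ] ℝ).coeFn_compLpL v

lemma comp_axisField (i j : Fin 2) (f : L2 D ℝ) :
    comp j (axisField i f) = if j = i then f else 0 := by
  refine Lp.ext ?_
  filter_upwards [coeFn_comp j (axisField i f), coeFn_axisField i f,
    Lp.coeFn_zero ℝ 2 (volume.restrict D : Measure R2)] with x h1 h2 h0
  rw [h1, h2]
  split_ifs with hij
  · simp [hij]
  · rw [h0]
    simp [hij]

lemma inner_axisField (i : Fin 2) (f : L2 D ℝ) (v : L2 D R2) :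
    inner ℝ (axisField i f) v = inner ℝ f (comp i v) := by
  rw [L2.inner_def, L2.inner_def]
  refine integral_congr_ae ?_
  filter_upwards [coeFn_axisField i f, coeFn_comp i v] with x h1 h2
  rw [h1, h2, real_inner_smul_left, EuclideanSpace.inner_single_left]
  simp [mul_comm]

lemma eq_zero_of_comp_eq_zero {v : L2 D R2} (hv : ∀ i, comp i v = 0) : v = 0 := by
  refine Lp.ext ?_
  have h : ∀ i, ∀ᵐ x ∂(volume.restrict D : Measure R2), v x i = 0 := by
    intro i
    filter_upwards [coeFn_comp i v, Lp.coeFn_zero ℝ 2 (volume.restrict D : Measure R2)]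
      with x h1 h0
    rw [← h1, hv i, h0, Pi.zero_apply]
  filter_upwards [ae_all_iff.2 h, Lp.coeFn_zero R2 2 (volume.restrict D : Measure R2)]
    with x hx h0
  rw [h0]
  ext i
  exact hx i

/-- Displacements `(v, v₃) ∈ H¹(D; ℝ²) × H²(D)` for which the traces of `v`, `v₃` and `∇v₃`
vanish. -/
def IsTraceFree (D : Set R2) (p : PlateV D) : Prop :=
  MemPlateH D p ∧ IsPlateTrace D p (fun _ => 0) (fun _ => 0) (fun _ => 0)

lemma isTraceFree_zero (hD : IsOpen D) : IsTraceFree D 0 :=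
  ⟨memPlateH_zero hD, isPlateTrace_zero hD⟩

lemma IsTest.isTraceFree_inPlane (hD : IsOpen D) {η : R2 → ℝ} (h : IsTest D η) (i : Fin 2) :
    IsTraceFree D (WithLp.toLp 2 (axisField i h.toL2, 0)) := by
  have h0 := isTraceFree_zero hD
  refine ⟨⟨fun j => ?_, h0.1.2⟩, fun j => ?_, h0.2.2⟩
  · rw [WithLp.toLp_fst, comp_axisField]
    split_ifs
    · exact h.memH1
    · exact memH1_zero
  · rw [WithLp.toLp_fst, comp_axisField]
    split_ifs
    · exact h.isTrace_zero hD
    · exact Plates.isTrace_zero hD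

lemma IsTest.isTraceFree_outOfPlane (hD : IsOpen D) {η : R2 → ℝ} (h : IsTest D η) :
    IsTraceFree D (WithLp.toLp 2 (0, h.toL2)) := by
  have h0 := isTraceFree_zero hD
  refine ⟨⟨h0.1.1, h.memH2 hD⟩, h0.2.1, h.isTrace_zero hD, fun i => ?_⟩
  rw [WithLp.toLp_snd, h.weakPartial_toL2 hD]
  exact (h.pderiv i).isTrace_zero hD

lemma eq_zero_of_inner_isTraceFree_eq_zero (hD : IsOpen D) {q : PlateV D}
    (hq : ∀ p, IsTraceFree D p → inner ℝ p q = 0) : q = 0 := by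
  have h1 : q.fst = 0 := by
    refine eq_zero_of_comp_eq_zero fun i => eq_zero_of_inner_test_eq_zero hD fun η h => ?_
    have := hq _ (h.isTraceFree_inPlane hD i)
    rwa [WithLp.prod_inner_apply, inner_zero_left, add_zero, inner_axisField] at this
  have h2 : q.snd = 0 := by
    refine eq_zero_of_inner_test_eq_zero hD fun η h => ?_
    have := hq _ (h.isTraceFree_outOfPlane hD)
    rwa [WithLp.prod_inner_apply, inner_zero_left, zero_add] at this
  exact WithLp.ofLp_injective 2 (Prod.ext h1 h2)

end TestDisplacements

/-! ### The coupled plates -/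

namespace CoupledPlates

variable (P : CoupledPlates)

lemma mem_W_of_isTraceFree {ψ : P.V} (h : IsTraceFree P.S ψ.fst) (h' : IsTraceFree P.S' ψ.snd) :
    ψ ∈ P.W := by
  refine ⟨h.1, h'.1, _, _, _, _, _, _, h.2, h'.2, ?_, ?_⟩
  · exact Eventually.of_forall fun x => ⟨rfl, rfl, fun n _ => inner_zero_left n⟩
  · exact Eventually.of_forall fun x x' _ => by simp

lemma dense_W : Dense (P.W : Set P.V) := by
  rw [Submodule.dense_iff_topologicalClosure_eq_top, Submodule.topologicalClosure_eq_top_iff,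
    Submodule.eq_bot_iff]
  intro G hG
  rw [Submodule.mem_orthogonal] at hG
  have hS := P.domain.isOpen
  have hS' := P.domain'.isOpen
  have h1 : G.fst = 0 := by
    refine eq_zero_of_inner_isTraceFree_eq_zero hS fun p hp => ?_
    have := hG (WithLp.toLp 2 (p, 0)) (P.mem_W_of_isTraceFree hp (isTraceFree_zero hS'))
    rwa [WithLp.prod_inner_apply, inner_zero_left, add_zero] at this
  have h2 : G.snd = 0 := by
    refine eq_zero_of_inner_isTraceFree_eq_zero hS' fun p hp => ?_
    have := hG (WithLp.toLp 2 (0, p)) (P.mem_W_of_isTraceFree (isTraceFree_zero hS) hp)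
    rwa [WithLp.prod_inner_apply, inner_zero_left, zero_add] at this
  exact WithLp.ofLp_injective 2 (Prod.ext h1 h2)

lemma inner_stressL2 (Φ Ψ : P.StressL2) :
    inner ℝ Φ Ψ = inner ℝ Φ.fst.fst Ψ.fst.fst + inner ℝ Φ.fst.snd Ψ.fst.snd +
      inner ℝ Φ.snd.fst Ψ.snd.fst + inner ℝ Φ.snd.snd Ψ.snd.snd := by
  simp only [WithLp.prod_inner_apply]
  exact (add_assoc _ _ _).symm

/-- The sign conventions of `B` (`-∇ˢv` and `∇²v₃`) and of `D` (`∇ˢv` and `-∇²v₃`) differ, but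
each sign occurs in both factors of a product. -/
lemma inner_C_B (m : Material) (φ ψ : P.W) : inner ℝ (P.C m (P.B φ)) (P.B ψ) = P.formD m φ ψ := by
  rw [inner_stressL2]
  simp only [C, B, plateB, formD, LinearMap.coe_mk, AddHom.coe_mk, WithLp.toLp_fst,
    WithLp.toLp_snd, applyField_neg, inner_neg_neg]

lemma formCinv_neg_C (m : Material) (Φ Ψ : P.StressL2) :
    P.formCinv m (-P.C m Φ) Ψ = -inner ℝ Φ Ψ := by
  rw [inner_stressL2]
  simp only [formCinv, C, WithLp.neg_fst, WithLp.neg_snd, WithLp.toLp_fst, WithLp.toLp_snd,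
    applyField_neg, applyField_inverse_apply m.C₁_isInvertible,
    applyField_inverse_apply m.C₂_isInvertible, inner_neg_left]
  ring

lemma inner_Bstar (Ψ : P.Sig) (ψ : P.W) :
    inner ℝ (P.Bstar Ψ) (ψ : P.V) = inner ℝ (Ψ : P.StressL2) (P.B ψ) :=
  LinearPMap.adjoint_isFormalAdjoint (T := (⟨P.W, P.B⟩ : P.V →ₗ.[ℝ] P.StressL2)) P.dense_W Ψ ψ

end CoupledPlates

end Plates

end

theorem theorem3p1 (P : Plates.CoupledPlates) (m : Plates.Material) (F : P.V) (φ : P.W)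
    (hφ : P.SolvesDisplacement m F φ) :
    ∃ hΦ : -P.C m (P.B φ) ∈ P.Sig, P.SolvesMixed m F ⟨-P.C m (P.B φ), hΦ⟩ φ := by
  have key : ∀ ψ : P.W, inner ℝ (-F) (ψ : P.V) = inner ℝ (-P.C m (P.B φ)) (P.B ψ) := by
    intro ψ
    rw [inner_neg_left, inner_neg_left, P.inner_C_B, hφ ψ]
  have hΦ : -P.C m (P.B φ) ∈ P.Sig :=
    LinearPMap.mem_adjoint_domain_of_exists
      (T := (⟨P.W, P.B⟩ : P.V →ₗ.[ℝ] P.StressL2)) _ ⟨-F, key⟩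
  refine ⟨hΦ, fun Ψ => ?_, fun ψ => ?_⟩
  · rw [P.formCinv_neg_C, P.inner_Bstar, real_inner_comm, neg_add_cancel]
  · have e : P.Bstar ⟨-P.C m (P.B φ), hΦ⟩ = -F :=
      LinearPMap.adjoint_apply_eq (T := (⟨P.W, P.B⟩ : P.V →ₗ.[ℝ] P.StressL2)) P.dense_W
        ⟨-P.C m (P.B φ), hΦ⟩ key
    rw [e, inner_neg_left]
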